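/- Let $G$ be a second countable locally compact Hausdorff topological group and $H$ a closed subgroup of $G$. Assume that there is a proper $G$-invariant compatible metric on $G/H$, i.e. a metric $d$ on $G/H$ that induces the quotient topology, all of whose closed balls are compact, and such that $d(gx,gy)=d(x,y)$ for all $g\in G$ and $x,y\in G/H$. Let $L=\bigcap_{g\in G}gHg^{-1}$ be the kernel of the action of $G$ on $G/H$ by left translations. Then: (i) there is a non-zero relatively $G$-invariant positive Radon measure on $G/H$, i.e. a non-zero positive Radon measure $\mu$ for which there is a continuous homomorphism $\chi\colon G\to\mathbb{R}_{>0}$ with $g_*\mu=\chi(g)\,\mu$ for all $g\in G$; (ii) $H/L$ is maximally almost periodic, i.e. there is a continuous injective homomorphism from $H/L$ (with the quotient topology) into a compact Hausdorff group; (iii) $H$ is topologically almost normal in $G$, i.e. for every compact $K\subseteq G$ there is a compact $K'\subseteq G$ such that $HK\subseteq K'H$. -/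

import Mathlib

open MeasureTheory
open scoped Pointwise NNReal

/-- There is a proper `G`-invariant compatible metric on the `G`-space `X`: a distance that defines
the given topology of `X`, whose closed balls are compact, and that every `g : G` preserves. -/
def HasProperInvariantCompatibleMetric (G X : Type*) [t : TopologicalSpace X] [SMul G X] : Prop :=
  ∃ m : MetricSpace X,
    m.toUniformSpace.toTopologicalSpace = t ∧
    ProperSpace X ∧
    ∀ (g : G) (x y : X), dist (g • x) (g • y) = dist x y

/-- `μ` is relatively `G`-invariant: the translates of `μ` are multiples of `μ`, the factors being
given by a continuous homomorphism from `G` to the positive reals (a homomorphism from a group to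
the multiplicative monoid `ℝ≥0` takes no value zero). -/
def IsRelativelyInvariant (G : Type*) {X : Type*} [Group G] [TopologicalSpace G] [SMul G X]
    [MeasurableSpace X] (μ : Measure X) : Prop :=
  ∃ χ : G →* ℝ≥0, Continuous χ ∧ ∀ g : G, μ.map (fun x => g • x) = χ g • μ

/-- A topological group is maximally almost periodic if it has a continuous injective homomorphism
into a compact (Hausdorff) group. Restricting the universe is harmless: one may replace the compact
group by the closure of the image, which has at most `2 ^ 2 ^ |A|` elements. -/
def IsMaximallyAlmostPeriodic.{u} (A : Type u) [Group A] [TopologicalSpace A] : Prop :=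
  ∃ (K : Type u) (_ : Group K) (_ : TopologicalSpace K) (_ : IsTopologicalGroup K)
    (_ : CompactSpace K) (_ : T2Space K) (φ : A →* K), Continuous φ ∧ Function.Injective φ

/-- `H` is topologically almost normal in `G`: for every compact `C ⊆ G` there is a compact
`C' ⊆ G` with `H C ⊆ C' H`. -/
def IsTopologicallyAlmostNormal {G : Type*} [Group G] [TopologicalSpace G] (H : Subgroup G) :
    Prop :=
  ∀ C : Set G, IsCompact C → ∃ C' : Set G, IsCompact C' ∧ (H : Set G) * C ⊆ C' * (H : Set G)

/-- The kernel `L` of the action of `G` on `G ⧸ H` by left translations. -/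
def cosetActionKernel {G : Type*} [Group G] (H : Subgroup G) : Subgroup G :=
  (MulAction.toPermHom G (G ⧸ H)).ker

instance cosetActionKernel_normal {G : Type*} [Group G] (H : Subgroup G) :
    (cosetActionKernel H).Normal :=
  MonoidHom.normal_ker _

/-! Let `X` be `G ⧸ H` with the given metric and `x₀` the base coset. By properness of `X`, its
isometry group is locally compact under pointwise convergence, and evaluation at `x₀` pulls compact
sets back to compact sets. Pushing Haar measure forward by this evaluation gives (i), with `χ = 1`.
The stabilizer of `x₀` among the isometries is compact, and `H` acts through it with kernel `L`,
which gives (ii). For (iii), `H` preserves the balls about `x₀`, and these are compact, hence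
covered by images of compact subsets of `G`. -/

namespace IsometryEquiv

variable {X : Type*} [MetricSpace X]

/-- The topology of pointwise convergence of an isometry and its inverse. -/
instance instTopologicalSpace : TopologicalSpace (X ≃ᵢ X) :=
  TopologicalSpace.induced (fun f => ((f : X → X), ((f⁻¹ : X ≃ᵢ X) : X → X))) inferInstance

theorem isInducing_coe_inv :
    Topology.IsInducing fun f : X ≃ᵢ X => ((f : X → X), ((f⁻¹ : X ≃ᵢ X) : X → X)) :=
  ⟨rfl⟩

theorem continuous_iff_apply {Y : Type*} [TopologicalSpace Y] {F : Y → X ≃ᵢ X} :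
    Continuous F ↔ ∀ x, Continuous (fun y => F y x) ∧ Continuous fun y => (F y)⁻¹ x := by
  rw [isInducing_coe_inv.continuous_iff, continuous_prodMk, continuous_pi_iff, continuous_pi_iff,
    forall_and]
  rfl

theorem continuous_apply (x : X) : Continuous fun f : X ≃ᵢ X => f x :=
  (continuous_iff_apply.1 continuous_id x).1

theorem continuous_inv_apply (x : X) : Continuous fun f : X ≃ᵢ X => f⁻¹ x :=
  (continuous_iff_apply.1 continuous_id x).2

/-- Isometries are equicontinuous, so pointwise convergence already gives joint continuity. -/
theorem continuous_uncurry_apply : Continuous fun p : (X ≃ᵢ X) × X => p.1 p.2 := by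
  rw [continuous_iff_continuousAt]
  rintro ⟨f, x⟩
  rw [ContinuousAt, tendsto_iff_dist_tendsto_zero]
  have hf : Filter.Tendsto (fun p : (X ≃ᵢ X) × X => dist p.2 x + dist (p.1 x) (f x))
      (nhds (f, x)) (nhds 0) := by
    have h : Continuous fun p : (X ≃ᵢ X) × X => dist p.2 x + dist (p.1 x) (f x) :=
      (continuous_snd.dist continuous_const).add
        (((continuous_apply x).comp continuous_fst).dist continuous_const)
    simpa using h.tendsto (f, x)
  refine squeeze_zero (fun _ => dist_nonneg) (fun p => ?_) hf
  calc dist (p.1 p.2) (f x) ≤ dist (p.1 p.2) (p.1 x) + dist (p.1 x) (f x) := dist_triangle _ _ _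
    _ = dist p.2 x + dist (p.1 x) (f x) := by rw [p.1.isometry.dist_eq]

instance instIsTopologicalGroup : IsTopologicalGroup (X ≃ᵢ X) where
  continuous_mul := by
    refine continuous_iff_apply.2 fun x => ⟨?_, ?_⟩
    · exact continuous_uncurry_apply.comp
        (continuous_fst.prodMk ((continuous_apply x).comp continuous_snd))
    · have hinv : Continuous fun p : (X ≃ᵢ X) × (X ≃ᵢ X) => p.1⁻¹ :=
        continuous_iff_apply.2 fun y => ⟨(continuous_inv_apply y).comp continuous_fst, by
          simp only [inv_inv]
          exact (continuous_apply y).comp continuous_fst⟩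
      have hinv' : Continuous fun p : (X ≃ᵢ X) × (X ≃ᵢ X) => p.2⁻¹ :=
        continuous_iff_apply.2 fun y => ⟨(continuous_inv_apply y).comp continuous_snd, by
          simp only [inv_inv]
          exact (continuous_apply y).comp continuous_snd⟩
      simp only [mul_inv_rev, mul_apply]
      exact continuous_uncurry_apply.comp
        (hinv'.prodMk ((continuous_apply x).comp hinv))
  continuous_inv := continuous_iff_apply.2 fun x =>
    ⟨continuous_inv_apply x, by simpa using continuous_apply x⟩

instance instT2Space : T2Space (X ≃ᵢ X) :=
  T2Space.of_injective_continuous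
    (f := fun f : X ≃ᵢ X => (f : X → X)) DFunLike.coe_injective
    (continuous_pi continuous_apply)

/-- A pointwise limit of bijective isometries may fail to be surjective, hence the pairs. The second
equation forces the two maps to be mutually inverse, and both equations are closed conditions. -/
theorem range_coe_inv :
    Set.range (fun f : X ≃ᵢ X => ((f : X → X), ((f⁻¹ : X ≃ᵢ X) : X → X))) =
      {p | ∀ x y, dist (p.1 x) (p.1 y) = dist x y ∧ dist (p.1 x) y = dist x (p.2 y)} := by
  ext ⟨f, g⟩
  constructor
  · rintro ⟨e, he⟩ x y
    obtain ⟨rfl, rfl⟩ := Prod.mk.inj he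
    refine ⟨e.isometry.dist_eq x y, ?_⟩
    rw [← e.isometry.dist_eq x, apply_inv_self]
  · intro h
    have hgf : ∀ x, g (f x) = x := fun x => by
      simpa [eq_comm] using (h x (f x)).2
    have hfg : ∀ x, f (g x) = x := fun x => by
      simpa using (h (g x) x).2
    exact ⟨⟨⟨f, g, hgf, hfg⟩, Isometry.of_dist_eq fun x y => (h x y).1⟩, rfl⟩

theorem isClosedEmbedding_coe_inv :
    Topology.IsClosedEmbedding
      fun f : X ≃ᵢ X => ((f : X → X), ((f⁻¹ : X ≃ᵢ X) : X → X)) := by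
  refine ⟨⟨isInducing_coe_inv, fun f g h => DFunLike.coe_injective (Prod.mk.inj h).1⟩, ?_⟩
  rw [range_coe_inv]
  simp only [Set.ofPred_forall, Set.ofPred_and]
  refine isClosed_iInter fun x => isClosed_iInter fun y => IsClosed.inter ?_ ?_ <;>
    exact isClosed_eq (by fun_prop) (by fun_prop)

/-- Tychonoff, as for Arzelà–Ascoli: such an `f` and its inverse both send `x` into the compact ball
of radius `dist x x₀ + r` about `x₀`. -/
theorem isCompact_setOf_dist_apply_le [ProperSpace X] (x₀ : X) (r : ℝ) :
    IsCompact {f : X ≃ᵢ X | dist (f x₀) x₀ ≤ r} := by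
  have hK : IsCompact (Set.pi Set.univ fun x : X => Metric.closedBall x₀ (dist x x₀ + r)) :=
    isCompact_univ_pi fun x => isCompact_closedBall _ _
  refine (isClosedEmbedding_coe_inv.isCompact_preimage (hK.prod hK)).of_isClosed_subset
    (isClosed_le ((continuous_apply x₀).dist continuous_const) continuous_const) fun f hf => ?_
  have hbound : ∀ e : X ≃ᵢ X, dist (e x₀) x₀ ≤ r → ∀ x, dist (e x) x₀ ≤ dist x x₀ + r :=
    fun e he x => (dist_triangle _ (e x₀) _).trans
      (add_le_add (e.isometry.dist_eq x x₀).le he)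
  refine ⟨fun x _ => hbound f hf x, fun x _ => hbound f⁻¹ ?_ x⟩
  rw [← f.isometry.dist_eq, apply_inv_self, dist_comm]
  exact hf

theorem isCompact_preimage_apply [ProperSpace X] (x₀ : X) {C : Set X} (hC : IsCompact C) :
    IsCompact ((fun f : X ≃ᵢ X => f x₀) ⁻¹' C) := by
  obtain ⟨r, hr⟩ := hC.isBounded.subset_closedBall x₀
  exact (isCompact_setOf_dist_apply_le x₀ r).of_isClosed_subset
    (hC.isClosed.preimage (continuous_apply x₀)) fun f hf => hr hf

instance instLocallyCompactSpace [ProperSpace X] : LocallyCompactSpace (X ≃ᵢ X) := by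
  rcases isEmpty_or_nonempty X with hX | ⟨⟨x₀⟩⟩
  · have : Subsingleton (X ≃ᵢ X) := ⟨fun f g => ext fun x => isEmptyElim x⟩
    infer_instance
  · refine (isCompact_setOf_dist_apply_le x₀ 1).locallyCompactSpace_of_mem_nhds_of_group
      (x := 1) ?_
    exact Filter.mem_of_superset
      ((isOpen_lt ((continuous_apply x₀).dist continuous_const) continuous_const).mem_nhds
        (by simp : dist ((1 : X ≃ᵢ X) x₀) x₀ < 1)) fun f (hf : dist (f x₀) x₀ < 1) => hf.le

/-- The stabilizer of a point in the isometry group. -/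
def pointStabilizer (x₀ : X) : Subgroup (X ≃ᵢ X) where
  carrier := {f | f x₀ = x₀}
  one_mem' := rfl
  mul_mem' {f g} hf hg := by
    change f (g x₀) = x₀
    rw [show g x₀ = x₀ from hg, show f x₀ = x₀ from hf]
  inv_mem' {f} hf := by
    change f⁻¹ x₀ = x₀
    conv_lhs => rw [← show f x₀ = x₀ from hf]
    exact inv_apply_self f x₀

instance compactSpace_pointStabilizer [ProperSpace X] (x₀ : X) :
    CompactSpace (pointStabilizer x₀) :=
  isCompact_iff_compactSpace.1 (isCompact_preimage_apply x₀ isCompact_singleton)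

/-- The homomorphism into the isometry group given by an isometric action. -/
def constSMulHom (G X : Type*) [Group G] [MetricSpace X] [MulAction G X] [IsIsometricSMul G X] :
    G →* X ≃ᵢ X where
  toFun := IsometryEquiv.constSMul
  map_one' := ext fun x => one_smul G x
  map_mul' g h := ext fun x => mul_smul g h x

theorem continuous_constSMulHom {G : Type*} [Group G] [TopologicalSpace G]
    [IsTopologicalGroup G] [MulAction G X] [IsIsometricSMul G X] [ContinuousSMul G X] :
    Continuous (constSMulHom G X) := by
  refine continuous_iff_apply.2 fun x => ⟨continuous_id.smul continuous_const, ?_⟩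
  simp only [← map_inv]
  exact continuous_inv.smul continuous_const

end IsometryEquiv

/-- On a nonempty proper metric space there is a nonzero Radon measure that is invariant under all
isometries. -/
theorem exists_regular_measure_map_isometryEquiv_eq (X : Type*) [MetricSpace X] [ProperSpace X]
    [Nonempty X] [MeasurableSpace X] [BorelSpace X] :
    ∃ μ : Measure X, μ.Regular ∧ μ ≠ 0 ∧ ∀ e : X ≃ᵢ X, μ.map e = μ := by
  obtain ⟨x₀⟩ := ‹Nonempty X›
  let : MeasurableSpace (X ≃ᵢ X) := borel _
  have : BorelSpace (X ≃ᵢ X) := ⟨rfl⟩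
  have hmeas : Measurable fun f : X ≃ᵢ X => f x₀ :=
    (IsometryEquiv.continuous_apply x₀).measurable
  let ν : Measure (X ≃ᵢ X) := Measure.haar
  have hfin : IsFiniteMeasureOnCompacts (ν.map fun f : X ≃ᵢ X => f x₀) := ⟨fun C hC => by
    rw [Measure.map_apply hmeas hC.measurableSet]
    exact (IsometryEquiv.isCompact_preimage_apply x₀ hC).measure_lt_top⟩
  -- Regularity is automatic: a proper metric space is locally compact and second countable, and the
  -- measure is finite on compact sets.
  refine ⟨ν.map fun f => f x₀, inferInstance, ?_, fun e => ?_⟩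
  · rw [Ne, Measure.map_eq_zero_iff hmeas.aemeasurable]
    exact NeZero.ne ν
  · have he : (e ∘ fun f : X ≃ᵢ X => f x₀) = (fun f : X ≃ᵢ X => f x₀) ∘ fun f => e * f := rfl
    rw [Measure.map_map e.continuous.measurable hmeas, he,
      ← Measure.map_map hmeas (continuous_const_mul e).measurable, map_mul_left_eq_self]

theorem IsOpenMap.exists_isCompact_subset_image {X Y : Type*} [TopologicalSpace X]
    [TopologicalSpace Y] [WeaklyLocallyCompactSpace X] {f : X → Y} (hf : IsOpenMap f)
    (hsurj : Function.Surjective f) {C : Set Y} (hC : IsCompact C) :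
    ∃ K : Set X, IsCompact K ∧ C ⊆ f '' K := by
  refine hC.induction_on (p := fun s => ∃ K : Set X, IsCompact K ∧ s ⊆ f '' K)
    ⟨∅, isCompact_empty, Set.empty_subset _⟩ ?_ ?_ fun y _ => ?_
  · rintro s t hst ⟨K, hK, ht⟩
    exact ⟨K, hK, hst.trans ht⟩
  · rintro s t ⟨K, hK, hs⟩ ⟨K', hK', ht⟩
    exact ⟨K ∪ K', hK.union hK', by rw [Set.image_union]; exact Set.union_subset_union hs ht⟩
  · obtain ⟨x, rfl⟩ := hsurj y
    obtain ⟨K, hK, hx⟩ := exists_compact_mem_nhds x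
    exact ⟨f '' K, mem_nhdsWithin_of_mem_nhds (hf.image_mem_nhds hx), K, hK, subset_rfl⟩

theorem exists_isRelativelyInvariant_of_isIsometricSMul {G X : Type*} [Group G]
    [TopologicalSpace G] [MetricSpace X] [ProperSpace X] [Nonempty X] [MeasurableSpace X]
    [BorelSpace X] [MulAction G X] [IsIsometricSMul G X] :
    ∃ μ : Measure X, μ.Regular ∧ μ ≠ 0 ∧ IsRelativelyInvariant G μ := by
  obtain ⟨μ, hreg, hne, hinv⟩ := exists_regular_measure_map_isometryEquiv_eq X
  refine ⟨μ, hreg, hne, 1, continuous_const, fun g => ?_⟩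
  rw [MonoidHom.one_apply, one_smul]
  exact hinv (IsometryEquiv.constSMul g)

theorem isMaximallyAlmostPeriodic_stabilizer_quotient.{u} {G X : Type u} [Group G]
    [TopologicalSpace G] [IsTopologicalGroup G] [MetricSpace X] [ProperSpace X] [MulAction G X]
    [IsIsometricSMul G X] [ContinuousSMul G X] {H : Subgroup G} {x₀ : X}
    (hH : H ≤ MulAction.stabilizer G x₀) :
    IsMaximallyAlmostPeriodic (H ⧸ (MulAction.toPermHom G X).ker.subgroupOf H) := by
  let φ : H →* IsometryEquiv.pointStabilizer x₀ :=
    ((IsometryEquiv.constSMulHom G X).comp H.subtype).codRestrict _ fun h => hH h.2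
  have hφ : Continuous φ :=
    (IsometryEquiv.continuous_constSMulHom.comp continuous_subtype_val).subtype_mk _
  have hker : φ.ker = (MulAction.toPermHom G X).ker.subgroupOf H := by
    ext h
    rw [Subgroup.mem_subgroupOf, MonoidHom.mem_ker, MonoidHom.mem_ker, Subtype.ext_iff,
      DFunLike.ext_iff, Equiv.ext_iff]
    rfl
  refine ⟨IsometryEquiv.pointStabilizer x₀, inferInstance, inferInstance, inferInstance,
    inferInstance, inferInstance, QuotientGroup.lift _ φ hker.ge, ?_, ?_⟩
  · exact hφ.quotient_lift _
  · rw [← MonoidHom.ker_eq_bot_iff, QuotientGroup.ker_lift, hker, QuotientGroup.map_mk'_self]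

/-- If `h` fixes `x₀`, then `(h * c) • x₀` is as far from `x₀` as `c • x₀`, so a single compact ball
contains the whole orbit of `C • x₀` under the stabilizer. -/
theorem isTopologicallyAlmostNormal_stabilizer {G X : Type*} [Group G] [TopologicalSpace G]
    [WeaklyLocallyCompactSpace G] [MetricSpace X] [ProperSpace X] [MulAction G X]
    [IsIsometricSMul G X] [ContinuousSMul G X] [MulAction.IsPretransitive G X] {x₀ : X}
    (hopen : IsOpenMap fun g : G => g • x₀) :
    IsTopologicallyAlmostNormal (MulAction.stabilizer G x₀) := by
  intro C hC
  obtain ⟨r, hr⟩ := (hC.image (continuous_id.smul continuous_const :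
    Continuous fun g : G => g • x₀)).isBounded.subset_closedBall x₀
  obtain ⟨K, hK, hrK⟩ := hopen.exists_isCompact_subset_image (MulAction.surjective_smul G x₀)
    (isCompact_closedBall x₀ r)
  refine ⟨K, hK, ?_⟩
  rintro _ ⟨h, hh : h • x₀ = x₀, c, hc, rfl⟩
  have hmem : (h * c) • x₀ ∈ Metric.closedBall x₀ r := by
    rw [Metric.mem_closedBall, mul_smul]
    calc dist (h • c • x₀) x₀ = dist (h • c • x₀) (h • x₀) := by rw [hh]
      _ = dist (c • x₀) x₀ := dist_smul h _ _
      _ ≤ r := hr (Set.mem_image_of_mem _ hc)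
  obtain ⟨k, hk, hkc : k • x₀ = (h * c) • x₀⟩ := hrK hmem
  refine ⟨k, hk, k⁻¹ * (h * c), ?_, mul_inv_cancel_left k _⟩
  change (k⁻¹ * (h * c)) • x₀ = x₀
  rw [mul_smul, ← hkc, inv_smul_smul]

theorem mainTheorem5 {G : Type*} [Group G] [TopologicalSpace G] [IsTopologicalGroup G]
    [T2Space G] [LocallyCompactSpace G] [SecondCountableTopology G]
    (H : Subgroup G) (hH : IsClosed (H : Set G))
    [MeasurableSpace (G ⧸ H)] [BorelSpace (G ⧸ H)]
    (hd : HasProperInvariantCompatibleMetric G (G ⧸ H)) :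
    (∃ μ : Measure (G ⧸ H), μ.Regular ∧ μ ≠ 0 ∧ IsRelativelyInvariant G μ) ∧
    IsMaximallyAlmostPeriodic (H ⧸ (cosetActionKernel H).subgroupOf H) ∧
    IsTopologicallyAlmostNormal H := by
  obtain ⟨m, hm, hproper, hdist⟩ := hd
  have hiso : IsIsometricSMul G (G ⧸ H) := ⟨fun g => Isometry.of_dist_eq (hdist g)⟩
  -- This makes the metric topology definitionally the quotient topology, so that the existing
  -- instances on `G ⧸ H` apply.
  rw [← m.replaceTopology_eq hm.symm] at hproper hiso
  let := m.replaceTopology hm.symm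
  have hstab : MulAction.stabilizer G ((1 : G) : G ⧸ H) = H := MulAction.stabilizer_quotient H
  have hopen : IsOpenMap fun g : G => g • ((1 : G) : G ⧸ H) := by
    simpa only [MulAction.Quotient.smul_coe, smul_eq_mul, mul_one] using
      QuotientGroup.isOpenMap_coe (N := H)
  refine ⟨exists_isRelativelyInvariant_of_isIsometricSMul,
    isMaximallyAlmostPeriodic_stabilizer_quotient hstab.ge, ?_⟩
  simpa only [hstab] using isTopologicallyAlmostNormal_stabilizer hopen
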